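/- A function $\mathbb{Z}^n\to\mathbb{Z}^k$ is \emph{Presburger-definable} if its graph is first-order definable in $\langle\mathbb{Z};+,<,0,1\rangle$. For a set $F$ of functions (each $\mathbb{Z}^n\to\mathbb{Z}^k$ for some $n,k\ge 0$), let $F^\circ$ be the set of all functions computed by circuits (finite acyclic circuits over $\mathbb{Z}$, with finitely many input and output wires) whose gates compute integer linear functions $(x_1,\dots,x_n)\mapsto a_1x_1+\dots+a_nx_n+b$ with $a_i,b\in\mathbb{Z}$, or functions from $F$. The set $F$ is \emph{Presburger-complete} if $F^\circ$ is exactly the set of all Presburger-definable functions, and \emph{minimally Presburger-complete} if it is Presburger-complete but $F\setminus\{f\}$ is not Presburger-complete for any $f\in F$. Let $\max$ be the binary maximum on $\mathbb{Z}$, let $E(x,y)=y$ if $x=0$ and $E(x,y)=0$ otherwise, and for $m\in\mathbb{Z}\setminus\{0\}$ let $\mathrm{div}_m(x)=\lfloor x/m\rfloor$. Put $$\mathcal{B}=\{\max,E\}\cup\{\mathrm{div}_m : m\in\mathbb{Z}\setminus\{0\}\},\qquad \mathcal{B}^{\mathsf p}=\{\max,E\}\cup\{\mathrm{div}_p : p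 \text{ a (positive) prime number}\}.$$ Then $\mathcal{B}$ is Presburger-complete, $\mathcal{B}^{\mathsf p}$ is minimally Presburger-complete, and no finite set of functions is Presburger-complete. -/

import Mathlib

namespace PresburgerCircuits

/-- A function `ℤ^ins → ℤ^outs`, bundled with its numbers of arguments and of outputs. -/
structure IntFunction where
  ins : ℕ
  outs : ℕ
  toFun : (Fin ins → ℤ) → (Fin outs → ℤ)

/-- Circuits over a set `F` of functions. `Circuit F n w` is the type of circuits with `n` input
wires and `w` wires in total (the inputs included), given in a topological order of the gates:
each gate reads wires that are already present (wires may be read arbitrarily often) and appends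
its output wires. The gates compute either an integer linear function
`(x₁, …, x_k) ↦ a₁ x₁ + ⋯ + a_k x_k + b` or a function from `F`. -/
inductive Circuit (F : Set IntFunction) (n : ℕ) : ℕ → Type
  | inputs : Circuit F n n
  | linear {w k : ℕ} (C : Circuit F n w) (a : Fin k → ℤ) (b : ℤ) (src : Fin k → Fin w) :
      Circuit F n (w + 1)
  | gate {w : ℕ} (C : Circuit F n w) (g : IntFunction) (hg : g ∈ F) (src : Fin g.ins → Fin w) :
      Circuit F n (w + g.outs)

/-- The values carried by all the wires of a circuit, on the input `x`. -/
def Circuit.eval {F : Set IntFunction} {n : ℕ} :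
    {w : ℕ} → Circuit F n w → (Fin n → ℤ) → (Fin w → ℤ)
  | _, .inputs, x => x
  | _, .linear C a b src, x =>
      Fin.append (C.eval x) (fun _ : Fin 1 => ∑ i, a i * C.eval x (src i) + b)
  | _, .gate C g _ src, x =>
      Fin.append (C.eval x) (g.toFun fun i => C.eval x (src i))

/-- The set `F°` of all functions computed by circuits over `F`: some of the wires
(given by `out`) are designated as the output wires. -/
def computable (F : Set IntFunction) : Set IntFunction :=
  {f | ∃ (w : ℕ) (C : Circuit F f.ins w) (out : Fin f.outs → Fin w),
    ∀ (x : Fin f.ins → ℤ) (j : Fin f.outs), f.toFun x j = C.eval x (out j)}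

/-- The first-order language of `⟨ℤ; +, 0, 1, ≤⟩` (note that `x < y` is `¬ y ≤ x`). -/
abbrev presburgerLanguage : FirstOrder.Language :=
  FirstOrder.Language.sum FirstOrder.Language.presburger FirstOrder.Language.order

instance : FirstOrder.Language.order.Structure ℤ := FirstOrder.Language.orderStructure ℤ

/-- The Presburger-definable functions: those definable in Presburger arithmetic over `ℤ`, that is,
the graph of each coordinate function is first-order definable without parameters. (A finite
conjunction shows that this is the same as definability of the graph of the whole function.) -/
def presburgerDefinable : Set IntFunction :=
  {f | (∅ : Set ℤ).DefinableMap presburgerLanguage f.toFun}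

/-- `F` is Presburger-complete if `F°` is exactly the set of Presburger-definable functions. -/
def IsPresburgerComplete (F : Set IntFunction) : Prop :=
  computable F = presburgerDefinable

/-- `F` is minimally Presburger-complete if it is Presburger-complete and no member of `F` can be
removed. -/
def IsMinimallyPresburgerComplete (F : Set IntFunction) : Prop :=
  IsPresburgerComplete F ∧ ∀ f ∈ F, ¬ IsPresburgerComplete (F \ {f})

/-- The binary function `max`. -/
def maxFun : IntFunction := ⟨2, 1, fun x _ => max (x 0) (x 1)⟩

/-- The zero conditional: `E(x, y) = y` if `x = 0`, and `E(x, y) = 0` otherwise. -/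
def condFun : IntFunction := ⟨2, 1, fun x _ => if x 0 = 0 then x 1 else 0⟩

/-- The unary function `div_m : x ↦ ⌊x / m⌋` (used for `m ≠ 0` only). -/
def divFun (m : ℤ) : IntFunction := ⟨1, 1, fun x _ => ⌊(x 0 : ℚ) / (m : ℚ)⌋⟩

/-- The set `{max, E} ∪ {div_m : m ∈ ℤ, m ≠ 0}`. -/
def presburgerBasis : Set IntFunction :=
  {maxFun, condFun} ∪ {f | ∃ m : ℤ, m ≠ 0 ∧ f = divFun m}

/-- The set `{max, E} ∪ {div_p : p a (positive) prime number}`. -/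
def primePresburgerBasis : Set IntFunction :=
  {maxFun, condFun} ∪ {f | ∃ p : ℕ, p.Prime ∧ f = divFun (p : ℤ)}

end PresburgerCircuits

/-!
Circuits over Presburger-definable gates compute Presburger-definable functions
(`computable_subset_presburgerDefinable`), because definable functions compose.

Conversely, Presburger-definable subsets of `ℤ^n` are semilinear
(`isSemilinearSet_of_definable`), so the graph of a definable function `f` is a finite union of
proper linear sets `a + ℕ p₁ + ⋯ + ℕ pₖ`, with `p₁, …, pₖ` independent. As such a piece lies in a
graph, the periods remain independent, even over `ℤ`, after the last coordinate is dropped. Hence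
the coefficients of an argument `x` in the projection of the piece are `⌊ℓᵢ(x - a) / D⌋` for integer
linear forms `ℓᵢ` and a positive integer `D`; whether `x` lies in the projection is decided by an
equation, using `max`, and on the projection `f` is affine in the coefficients
(`exists_computes_of_isProperLinearSet`). The pieces are glued with `E`, and divisions by
composite numbers are iterated divisions by primes. This gives
`presburgerDefinable_subset_computable`.

That a function is not computed from given gates is shown by a property of functions `T → ℤ`
which is closed under integer linear combinations and preserved by the gates, hence by circuits, but
not by the function in question:
* without `max`, every unary circuit is affine on some set `{M k : |k| large}`, with the same
  slope at both ends (`not_preserves_maxFun`);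
* without `E`, circuits preserve boundedness of `y ↦ g (y, 0) - g (y, 1)`
  (`not_preserves_boundedGap_condFun`);
* without `div_p`, every unary circuit is affine on some set `{M k : k large}` with `p ∤ M`
  (`not_preserves_divFun`).

The last property also excludes finite complete sets: finitely many functions are computed by
circuits that together contain divisions by finitely many primes only, so they all preserve the
property attached to any other prime `p`, whereas `div_p` does not.
-/

namespace PresburgerCircuits

/-! ### Semilinearity of Presburger-definable sets of integers -/

section

open FirstOrder FirstOrder.Language Set

/-- Terms of Presburger arithmetic are affine functions of their variables. -/
lemma exists_realize_term_eq {α : Type*} (t : presburgerLanguage.Term α) :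
    ∃ (k : ℤ) (u : (α → ℤ) →+ ℤ), ∀ v : α → ℤ, t.realize v = k + u v := by
  induction t with
  | var i => exact ⟨0, Pi.evalAddMonoidHom _ i, fun v => by simp⟩
  | @func l f ts ih =>
    choose k u ih using ih
    rcases f with f | f
    · cases f with
      | zero => exact ⟨0, 0, fun v => rfl⟩
      | one => exact ⟨1, 0, fun v => rfl⟩
      | add =>
        refine ⟨k 0 + k 1, u 0 + u 1, fun v => ?_⟩
        change (ts 0).realize v + (ts 1).realize v = _
        rw [ih, ih, AddMonoidHom.add_apply]
        ring
    · exact isEmptyElim f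

lemma isSemilinearSet_Ici (c : ℤ) : IsSemilinearSet (Ici c) := by
  refine IsLinearSet.isSemilinearSet ⟨c, {1}, by simp, ?_⟩
  ext z
  simp only [mem_Ici, mem_vadd_set, SetLike.mem_coe, AddSubmonoid.mem_closure_singleton,
    vadd_eq_add]
  constructor
  · intro h
    exact ⟨z - c, ⟨(z - c).toNat, by simp; omega⟩, by ring⟩
  · rintro ⟨_, ⟨n, rfl⟩, rfl⟩
    simp

instance {α : Type*} [Finite α] : AddMonoid.FG (α → ℤ) :=
  Module.Finite.iff_addMonoid_fg.1 inferInstance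

/-- Bounded formulas define semilinear sets: atomic formulas are preimages of half-lines and points
under homomorphisms, and semilinear sets are closed under complement and projection. -/
lemma isSemilinearSet_boundedFormula_realize {α : Type*} [Finite α] {n : ℕ}
    (φ : presburgerLanguage.BoundedFormula α n) :
    IsSemilinearSet {v : α ⊕ Fin n → ℤ | φ.Realize (v ∘ Sum.inl) (v ∘ Sum.inr)} := by
  induction φ with simp only [BoundedFormula.Realize]
  | equal t₁ t₂ =>
    obtain ⟨k₁, u₁, h₁⟩ := exists_realize_term_eq t₁
    obtain ⟨k₂, u₂, h₂⟩ := exists_realize_term_eq t₂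
    convert! (IsSemilinearSet.singleton (k₂ - k₁)).preimage (u₁ - u₂) using 1
    ext v
    simp only [mem_ofPred_eq, mem_preimage, mem_singleton_iff, AddMonoidHom.sub_apply,
      Sum.elim_comp_inl_inr, h₁, h₂]
    omega
  | @rel n l R ts =>
    rcases R with R | R
    · exact isEmptyElim R
    · cases R
      obtain ⟨k₁, u₁, h₁⟩ := exists_realize_term_eq (ts 0)
      obtain ⟨k₂, u₂, h₂⟩ := exists_realize_term_eq (ts 1)
      convert! (isSemilinearSet_Ici (k₁ - k₂)).preimage (u₂ - u₁) using 1
      ext v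
      have : ∀ w : Fin 2 → ℤ, Structure.RelMap (L := presburgerLanguage)
          (Sum.inr .le : presburgerLanguage.Relations 2) w ↔ w 0 ≤ w 1 := fun w => Iff.rfl
      simp only [mem_ofPred_eq, mem_preimage, mem_Ici, AddMonoidHom.sub_apply, this,
        Sum.elim_comp_inl_inr, h₁, h₂]
      omega
  | falsum => exact .empty
  | imp _ _ ih₁ ih₂ =>
    convert! (ih₂.compl.inter ih₁).compl using 1
    simp [ofPred_inter_eq_sep, imp_iff_not_or, compl_ofPred]
  | @all n φ ih =>
    let e := (Equiv.sumAssoc α (Fin n) (Fin 1)).trans (Equiv.sumCongr (.refl α) finSumFinEquiv)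
    rw [← isSemilinearSet_image_iff (LinearEquiv.funCongrLeft ℤ ℤ e)] at ih
    convert! ih.compl.proj.compl using 1
    simp_rw [compl_ofPred, not_exists, Fin.forall_fin_succ_pi, Fin.forall_fin_zero_pi,
      mem_compl_iff, mem_image, not_not, ← LinearEquiv.eq_symm_apply, LinearEquiv.funCongrLeft_symm,
      exists_eq_right, mem_ofPred, LinearEquiv.funCongrLeft_apply, LinearMap.funLeft,
      LinearMap.coe_mk, AddHom.coe_mk]
    congr! 4
    ext i
    cases i using Fin.lastCases <;> simp [e]

theorem isSemilinearSet_of_definable {α : Type*} [Finite α] {s : Set (α → ℤ)}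
    (hs : (∅ : Set ℤ).Definable presburgerLanguage s) : IsSemilinearSet s := by
  obtain ⟨φ, rfl⟩ := empty_definable_iff.1 hs
  let e := Equiv.sumEmpty α (Fin 0)
  convert! (isSemilinearSet_boundedFormula_realize φ).image (LinearMap.funLeft ℤ ℤ e.symm)
  ext x
  simp only [mem_ofPred_eq, mem_image]
  rw [(e.arrowCongr (.refl ℤ)).exists_congr_left]
  simp [Formula.Realize, Unique.eq_default, Function.comp_def, LinearMap.funLeft, e]

/-! ### Definability of the functions computed by circuits -/

section Definable

variable {α : Type*} {f g : (α → ℤ) → ℤ}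

lemma definableFun_zero :
    (∅ : Set ℤ).DefinableFun presburgerLanguage (fun _ : α → ℤ => (0 : ℤ)) := by
  have := Term.definableFun_realize (M := ℤ) (Term.func
    (Sum.inl .zero : presburgerLanguage.Functions 0) ![] : presburgerLanguage.Term α)
  exact this

lemma definableFun_one :
    (∅ : Set ℤ).DefinableFun presburgerLanguage (fun _ : α → ℤ => (1 : ℤ)) := by
  have := Term.definableFun_realize (M := ℤ) (Term.func
    (Sum.inl .one : presburgerLanguage.Functions 0) ![] : presburgerLanguage.Term α)
  exact this

lemma definableFun_add (hf : (∅ : Set ℤ).DefinableFun presburgerLanguage f)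
    (hg : (∅ : Set ℤ).DefinableFun presburgerLanguage g) :
    (∅ : Set ℤ).DefinableFun presburgerLanguage (fun v => f v + g v) := by
  have h := DefinableFun.fun_symbol (M := ℤ) (L := presburgerLanguage) (n := 2)
    (Sum.inl presburgerFunc.add)
  refine h.comp (g := fun v => ![f v, g v]) ?_
  intro i
  fin_cases i
  · exact hf
  · exact hg

lemma definableFun_neg (hf : (∅ : Set ℤ).DefinableFun presburgerLanguage f) :
    (∅ : Set ℤ).DefinableFun presburgerLanguage (fun v => -f v) := by
  have h : (∅ : Set ℤ).DefinableFun presburgerLanguage (fun v : Fin 1 → ℤ => -v 0) := by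
    have := (definableFun_add (DefinableFun.proj presburgerLanguage (i := some (0 : Fin 1)))
      (DefinableFun.proj _ (i := none))).ofPred_eq definableFun_zero
    rw [DefinableFun]
    convert! this using 1
    ext v
    simp [Function.tupleGraph]
    omega
  exact h.comp (g := fun v => ![f v]) (by intro i; fin_cases i; exact hf)

lemma definableFun_natCast_mul (n : ℕ) (hf : (∅ : Set ℤ).DefinableFun presburgerLanguage f) :
    (∅ : Set ℤ).DefinableFun presburgerLanguage (fun v => n * f v) := by
  induction n with
  | zero => simpa using definableFun_zero
  | succ n ih => simpa [add_mul] using definableFun_add ih hf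

lemma definableFun_intCast_mul (a : ℤ) (hf : (∅ : Set ℤ).DefinableFun presburgerLanguage f) :
    (∅ : Set ℤ).DefinableFun presburgerLanguage (fun v => a * f v) := by
  obtain ⟨n, rfl | rfl⟩ := a.eq_nat_or_neg
  · exact definableFun_natCast_mul n hf
  · simpa using definableFun_neg (definableFun_natCast_mul n hf)

lemma definableFun_intCast (a : ℤ) :
    (∅ : Set ℤ).DefinableFun presburgerLanguage (fun _ : α → ℤ => a) := by
  simpa using definableFun_intCast_mul a (α := α) definableFun_one

lemma definableFun_sum {ι : Type*} (s : Finset ι) {f : ι → (α → ℤ) → ℤ}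
    (hf : ∀ i ∈ s, (∅ : Set ℤ).DefinableFun presburgerLanguage (f i)) :
    (∅ : Set ℤ).DefinableFun presburgerLanguage (fun v => ∑ i ∈ s, f i v) := by
  classical
  induction s using Finset.induction_on with
  | empty => simpa using definableFun_zero
  | insert i s hi ih =>
    simp only [Finset.sum_insert hi]
    exact definableFun_add (hf i (by simp)) (ih fun j hj => hf j (by simp [hj]))

lemma definable_ofPred_le (hf : (∅ : Set ℤ).DefinableFun presburgerLanguage f)
    (hg : (∅ : Set ℤ).DefinableFun presburgerLanguage g) :
    (∅ : Set ℤ).Definable presburgerLanguage {v | f v ≤ g v} := by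
  have h : (∅ : Set ℤ).Definable presburgerLanguage {v : Fin 2 → ℤ | v 0 ≤ v 1} := by
    refine empty_definable_iff.2 ⟨Relations.formula₂
      (Sum.inr .le : presburgerLanguage.Relations 2) (Term.var 0) (Term.var 1), ?_⟩
    ext v
    exact (Formula.realize_rel₂ (L := presburgerLanguage)
      (R := (Sum.inr .le : presburgerLanguage.Relations 2))
      (t₁ := Term.var 0) (t₂ := Term.var 1) (v := v)).symm
  exact h.preimage_map (F := fun v => ![f v, g v])
    (by intro i; fin_cases i; exacts [hf, hg])

end Definable

lemma maxFun_mem_presburgerDefinable : maxFun ∈ presburgerDefinable := by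
  intro j
  simp only [maxFun, max_def]
  refine DefinableFun.ite
    (definable_ofPred_le (DefinableFun.proj _ (i := 0)) (DefinableFun.proj _ (i := 1)))
    (DefinableFun.proj _) (DefinableFun.proj _)

lemma condFun_mem_presburgerDefinable : condFun ∈ presburgerDefinable := by
  intro j
  exact DefinableFun.ite ((DefinableFun.proj _ (i := (0 : Fin 2))).ofPred_eq definableFun_zero)
    (DefinableFun.proj _) definableFun_zero

/-- The value `⌊x / m⌋` is singled out by inequalities between integer linear functions. -/
lemma floor_ratCast_div_eq_iff {m : ℤ} (hm : m ≠ 0) (x y : ℤ) :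
    ⌊(x : ℚ) / (m : ℚ)⌋ = y ↔
      (0 < m ∧ m * y ≤ x ∧ x + 1 ≤ m * y + m) ∨ (m < 0 ∧ x ≤ m * y ∧ m * y + m + 1 ≤ x) := by
  rw [Int.floor_eq_iff]
  rcases hm.lt_or_gt with h | h
  · have h' : (m : ℚ) < 0 := by exact_mod_cast h
    rw [le_div_iff_of_neg h', div_lt_iff_of_neg h', or_iff_right (by omega)]
    norm_cast
    rw [mul_comm y, add_mul, mul_comm y, one_mul]
    omega
  · have h' : (0 : ℚ) < m := by exact_mod_cast h
    rw [le_div_iff₀ h', div_lt_iff₀ h', or_iff_left (by omega)]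
    norm_cast
    rw [mul_comm y, add_mul, mul_comm y, one_mul]
    omega

lemma divFun_mem_presburgerDefinable {m : ℤ} (hm : m ≠ 0) : divFun m ∈ presburgerDefinable := by
  intro j
  have hx := DefinableFun.proj presburgerLanguage (A := (∅ : Set ℤ)) (i := some (0 : Fin 1))
  have hy := definableFun_intCast_mul m
    (DefinableFun.proj presburgerLanguage (A := (∅ : Set ℤ)) (i := (none : Option (Fin 1))))
  have hc (b : ℤ) := definableFun_intCast (α := Option (Fin 1)) b
  suffices h : (∅ : Set ℤ).Definable presburgerLanguage
      {v : Option (Fin 1) → ℤ | ⌊(v (some 0) : ℚ) / (m : ℚ)⌋ = v none} from h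
  simp only [floor_ratCast_div_eq_iff hm]
  rcases hm.lt_or_gt with h | h
  · simpa [h, h.not_gt, ofPred_and] using (definable_ofPred_le hx hy).inter
      (definable_ofPred_le (definableFun_add (definableFun_add hy (hc m)) (hc 1)) hx)
  · simpa [h, h.not_gt, ofPred_and] using (definable_ofPred_le hy hx).inter
      (definable_ofPred_le (definableFun_add hx (hc 1)) (definableFun_add hy (hc m)))

/-- Circuits with Presburger-definable gates compute Presburger-definable functions. -/
theorem computable_subset_presburgerDefinable {F : Set IntFunction}
    (hF : F ⊆ presburgerDefinable) : computable F ⊆ presburgerDefinable := by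
  rintro f ⟨w, C, out, hf⟩ j
  suffices h : ∀ i, (∅ : Set ℤ).DefinableFun presburgerLanguage (fun x => C.eval x i) by
    simpa only [hf] using h (out j)
  clear hf out
  induction C with
  | inputs => exact fun i => DefinableFun.proj _
  | linear C a b src ih =>
    refine Fin.addCases (fun i => ?_) (fun i => ?_)
    · simpa only [Circuit.eval, Fin.append_left] using ih i
    · simp only [Circuit.eval, Fin.append_right]
      exact definableFun_add (definableFun_sum _ fun i _ => definableFun_intCast_mul _ (ih _))
        (definableFun_intCast b)
  | gate C g hg src ih =>
    refine Fin.addCases (fun i => ?_) (fun i => ?_)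
    · simpa only [Circuit.eval, Fin.append_left] using ih i
    · simp only [Circuit.eval, Fin.append_right]
      exact (hF hg i).comp (fun k => ih (src k))

end

/-! ### Composing circuits -/

section

open Set Pointwise

/-- `g` is the function on some wire of a circuit over `F` with `n` inputs. -/
def Computes (F : Set IntFunction) {n : ℕ} (g : (Fin n → ℤ) → ℤ) : Prop :=
  ∃ (w : ℕ) (C : Circuit F n w) (i : Fin w), ∀ x, C.eval x i = g x

section Computes

variable {F : Set IntFunction} {n : ℕ}

lemma Circuit.exists_input_wires {w : ℕ} (C : Circuit F n w) :
    ∃ e : Fin n → Fin w, ∀ x i, C.eval x (e i) = x i := by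
  induction C with
  | inputs => exact ⟨id, fun _ _ => rfl⟩
  | linear C a b src ih =>
    obtain ⟨e, he⟩ := ih
    exact ⟨fun i => Fin.castAdd _ (e i), fun x i => by simp [Circuit.eval, he]⟩
  | gate C g hg src ih =>
    obtain ⟨e, he⟩ := ih
    exact ⟨fun i => Fin.castAdd _ (e i), fun x i => by simp [Circuit.eval, he]⟩

/-- Two circuits on the same inputs can be merged into one circuit carrying all their wires. -/
lemma Circuit.exists_merge {w₁ w₂ : ℕ} (C₁ : Circuit F n w₁) (C₂ : Circuit F n w₂) :
    ∃ (w : ℕ) (C : Circuit F n w) (e₁ : Fin w₁ → Fin w) (e₂ : Fin w₂ → Fin w),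
      (∀ x i, C.eval x (e₁ i) = C₁.eval x i) ∧ ∀ x i, C.eval x (e₂ i) = C₂.eval x i := by
  induction C₂ with
  | inputs =>
    obtain ⟨e, he⟩ := C₁.exists_input_wires
    exact ⟨_, C₁, id, e, fun _ _ => rfl, he⟩
  | linear C₂ a b src ih =>
    obtain ⟨w, C, e₁, e₂, h₁, h₂⟩ := ih
    refine ⟨_, C.linear a b (e₂ ∘ src), fun i => Fin.castAdd _ (e₁ i),
      Fin.append (fun i => Fin.castAdd _ (e₂ i)) (Fin.natAdd _), fun x i => ?_, fun x i => ?_⟩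
    · simp only [Circuit.eval, Fin.append_left, h₁]
    · refine Fin.addCases (fun i => ?_) (fun i => ?_) i <;>
        simp only [Circuit.eval, Fin.append_left, Fin.append_right, h₂, Function.comp_apply]
  | gate C₂ g hg src ih =>
    obtain ⟨w, C, e₁, e₂, h₁, h₂⟩ := ih
    refine ⟨_, C.gate g hg (e₂ ∘ src), fun i => Fin.castAdd _ (e₁ i),
      Fin.append (fun i => Fin.castAdd _ (e₂ i)) (Fin.natAdd _), fun x i => ?_, fun x i => ?_⟩
    · simp only [Circuit.eval, Fin.append_left, h₁]
    · refine Fin.addCases (fun i => ?_) (fun i => ?_) i <;>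
        simp only [Circuit.eval, Fin.append_left, Fin.append_right, h₂, Function.comp_apply]

/-- Finitely many functions computed by circuits are computed by one circuit. -/
lemma Computes.exists_circuit {k : ℕ} {g : Fin k → (Fin n → ℤ) → ℤ}
    (hg : ∀ i, Computes F (g i)) :
    ∃ (w : ℕ) (C : Circuit F n w) (out : Fin k → Fin w), ∀ x i, C.eval x (out i) = g i x := by
  induction k with
  | zero => exact ⟨n, .inputs, Fin.elim0, fun _ i => i.elim0⟩
  | succ k ih =>
    obtain ⟨w₁, C₁, out, h₁⟩ := ih fun i => hg i.castSucc
    obtain ⟨w₂, C₂, i₂, h₂⟩ := hg (Fin.last k)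
    obtain ⟨w, C, e₁, e₂, h₁', h₂'⟩ := C₁.exists_merge C₂
    refine ⟨w, C, Fin.snoc (α := fun _ => Fin w) (fun i => e₁ (out i)) (e₂ i₂), fun x i => ?_⟩
    refine Fin.lastCases ?_ (fun i => ?_) i
    · rw [Fin.snoc_last, h₂', h₂]
    · rw [Fin.snoc_castSucc, h₁', h₁]

theorem mem_computable_of_computes {f : IntFunction}
    (hf : ∀ j, Computes F fun x => f.toFun x j) : f ∈ computable F := by
  obtain ⟨w, C, out, h⟩ := Computes.exists_circuit hf
  exact ⟨w, C, out, fun x j => (h x j).symm⟩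

lemma Computes.of_eq {g h : (Fin n → ℤ) → ℤ} (hg : Computes F g) (hgh : ∀ x, g x = h x) :
    Computes F h :=
  (funext hgh : g = h) ▸ hg

lemma computes_input (i : Fin n) : Computes F fun x => x i :=
  ⟨n, .inputs, i, fun _ => rfl⟩

lemma Computes.gate {f : IntFunction} (hf : f ∈ F) {g : Fin f.ins → (Fin n → ℤ) → ℤ}
    (hg : ∀ i, Computes F (g i)) (j : Fin f.outs) :
    Computes F fun x => f.toFun (fun i => g i x) j := by
  obtain ⟨w, C, out, h⟩ := Computes.exists_circuit hg
  exact ⟨_, C.gate f hf out, Fin.natAdd _ j, fun x => by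
    simp only [Circuit.eval, Fin.append_right, h]⟩

lemma Computes.linear {k : ℕ} (a : Fin k → ℤ) (b : ℤ) {g : Fin k → (Fin n → ℤ) → ℤ}
    (hg : ∀ i, Computes F (g i)) : Computes F fun x => ∑ i, a i * g i x + b := by
  obtain ⟨w, C, out, h⟩ := Computes.exists_circuit hg
  exact ⟨_, C.linear a b out, Fin.natAdd _ 0, fun x => by
    simp only [Circuit.eval, Fin.append_right, h]⟩

lemma computes_const (b : ℤ) : Computes F fun _ : Fin n → ℤ => b :=
  (Computes.linear (k := 0) Fin.elim0 b (g := Fin.elim0) fun i => i.elim0).of_eq (by simp)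

variable {g h : (Fin n → ℤ) → ℤ}

lemma Computes.add (hg : Computes F g) (hh : Computes F h) : Computes F fun x => g x + h x :=
  (Computes.linear ![1, 1] 0 (g := ![g, h]) (by simp [Fin.forall_fin_two, hg, hh])).of_eq
    (by simp)

lemma Computes.const_mul (a : ℤ) (hg : Computes F g) : Computes F fun x => a * g x :=
  (Computes.linear ![a] 0 (g := ![g]) (by simp [hg])).of_eq (by simp)

lemma Computes.neg (hg : Computes F g) : Computes F fun x => -g x :=
  (hg.const_mul (-1)).of_eq (by simp)

lemma Computes.sub (hg : Computes F g) (hh : Computes F h) : Computes F fun x => g x - h x :=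
  (hg.add hh.neg).of_eq fun _ => (sub_eq_add_neg _ _).symm

lemma Computes.sum {ι : Type*} (s : Finset ι) {g : ι → (Fin n → ℤ) → ℤ}
    (hg : ∀ i, Computes F (g i)) : Computes F fun x => ∑ i ∈ s, g i x := by
  classical
  induction s using Finset.induction_on with
  | empty => simpa using computes_const 0
  | insert i s hi ih =>
    simp only [Finset.sum_insert hi]
    exact (hg i).add ih

lemma Computes.max (hF : maxFun ∈ F) (hg : Computes F g) (hh : Computes F h) :
    Computes F fun x => max (g x) (h x) :=
  Computes.gate hF (g := ![g, h]) (Fin.forall_fin_two.2 ⟨hg, hh⟩) (0 : Fin 1)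

lemma Computes.abs (hF : maxFun ∈ F) (hg : Computes F g) : Computes F fun x => |g x| :=
  hg.max hF hg.neg

lemma Computes.cond (hF : condFun ∈ F) (hg : Computes F g) (hh : Computes F h) :
    Computes F fun x => if g x = 0 then h x else 0 :=
  Computes.gate hF (g := ![g, h]) (Fin.forall_fin_two.2 ⟨hg, hh⟩) (0 : Fin 1)

lemma Computes.ite (hF : condFun ∈ F) {c : (Fin n → ℤ) → ℤ} (hc : Computes F c)
    (hg : Computes F g) (hh : Computes F h) :
    Computes F fun x => if c x = 0 then g x else h x :=
  (hh.add (hc.cond hF (hg.sub hh))).of_eq fun x => by split_ifs <;> simp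

/-- Divisions by primes suffice for all divisions, since `⌊⌊x / p⌋ / m⌋ = ⌊x / (p m)⌋`. -/
lemma Computes.ediv (hF : ∀ p : ℕ, p.Prime → divFun p ∈ F) (hg : Computes F g) {m : ℕ}
    (hm : m ≠ 0) : Computes F fun x => g x / m := by
  induction m using Nat.recOnMul generalizing g with
  | zero => exact absurd rfl hm
  | one => simpa using hg
  | prime p hp =>
    refine (Computes.gate (hF p hp) (g := ![g]) (fun i => ?_) (0 : Fin 1)).of_eq
      fun x => ?_
    · rw [Subsingleton.elim (α := Fin 1) i 0]; exact hg
    · simpa [divFun] using Rat.floor_intCast_div_natCast (g x) p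
  | mul a b iha ihb =>
    refine (ihb (iha hg (left_ne_zero_of_mul hm)) (right_ne_zero_of_mul hm)).of_eq fun x => ?_
    rw [Nat.cast_mul, Int.ediv_ediv_of_nonneg (by positivity)]

end Computes

/-! ### Circuits for functions with a semilinear graph -/

/-- Integral dual vectors, up to a common denominator `D`, of an independent family in `ℤ^n`. -/
lemma exists_dual_vectors {n : ℕ} {τ : Type*} [Fintype τ] [DecidableEq τ] {p : τ → Fin n → ℤ}
    (hp : LinearIndependent ℤ p) :
    ∃ (D : ℕ) (l : τ → Fin n → ℤ), D ≠ 0 ∧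
      ∀ s t, ∑ i, l s i * p t i = if s = t then (D : ℤ) else 0 := by
  let q : τ → Fin n → ℚ := fun t i => p t i
  have hq : LinearIndependent ℚ q := by
    rw [← LinearIndependent.iff_fractionRing ℤ ℚ]
    refine hp.map' ((Int.castAddHom ℚ).compLeft (Fin n)).toIntLinearMap ?_
    refine LinearMap.ker_eq_bot.2 fun x y hxy => funext fun i => ?_
    simpa using congrFun hxy i
  obtain ⟨L, hL⟩ := LinearMap.exists_leftInverse_of_injective (Fintype.linearCombination ℚ q)
    (LinearMap.ker_eq_bot.2 hq.fintypeLinearCombination_injective)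
  have hLq (t : τ) : L (q t) = Pi.single t 1 := by
    have := LinearMap.congr_fun hL (Pi.single t 1)
    simpa [Fintype.linearCombination_apply_single] using this
  obtain ⟨b, hb⟩ := IsLocalization.exist_integer_multiples_of_finite (nonZeroDivisors ℤ)
    (fun k : τ × Fin n => L (Pi.single k.2 1) k.1)
  choose l hl using fun k => hb k
  -- Multiplying once more by `b` makes the common denominator positive.
  refine ⟨((b : ℤ) ^ 2).natAbs, fun s i => b * l (s, i), by simp, fun s t => ?_⟩
  have hqt : q t = ∑ i, (p t i : ℚ) • Pi.single i (1 : ℚ) := by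
    ext i
    simp [q, Finset.sum_apply, Pi.single_apply]
  have hst : ∑ i, (p t i : ℚ) * L (Pi.single i 1) s = if s = t then 1 else 0 := by
    have := congrFun (hLq t) s
    rw [hqt] at this
    simpa [Pi.single_apply] using this
  have hl' (i : Fin n) : (l (s, i) : ℚ) = b * L (Pi.single i 1) s := by
    simpa using hl (s, i)
  rw [Int.natCast_natAbs, abs_of_nonneg (sq_nonneg _)]
  have : ((∑ i, (b : ℤ) * l (s, i) * p t i : ℤ) : ℚ) = (b : ℚ) ^ 2 * if s = t then 1 else 0 := by
    rw [← hst, Finset.mul_sum]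
    push_cast
    refine Finset.sum_congr rfl fun i _ => ?_
    rw [hl']
    ring
  split_ifs at this ⊢ with h
  · exact_mod_cast this.trans (mul_one _)
  · exact_mod_cast this.trans (mul_zero _)

/-- On a proper linear piece of its graph, a function is computed by a circuit, and another circuit
decides membership in the projection of the piece. Since the piece is part of a graph, its periods
stay independent when the last coordinate is dropped; the coefficients `c` of `x` with respect to
them are given by divisions, and the value is an affine function of `c`. -/
lemma exists_computes_of_isProperLinearSet {F : Set IntFunction} (hmax : maxFun ∈ F)
    (hdiv : ∀ p : ℕ, p.Prime → divFun p ∈ F) {n : ℕ} {f : (Fin n → ℤ) → ℤ}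
    {s : Set (Option (Fin n) → ℤ)} (hs : IsProperLinearSet s) (hsf : s ⊆ f.tupleGraph) :
    ∃ c g : (Fin n → ℤ) → ℤ, Computes F c ∧ Computes F g ∧ (∀ x, c x = 0 → g x = f x) ∧
      ∀ v ∈ s, c (v ∘ some) = 0 := by
  classical
  obtain ⟨a, t, ht, rfl⟩ := isProperLinearSet_iff.1 hs
  let p : t → Fin n → ℤ := fun r i => r.1 (some i)
  have hmem (m : t → ℕ) : a + ∑ r, m r • r.1 ∈
      a +ᵥ (AddSubmonoid.closure (t : Set (Option (Fin n) → ℤ)) : Set (Option (Fin n) → ℤ)) :=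
    ⟨_, AddSubmonoid.sum_mem _ fun r _ => AddSubmonoid.nsmul_mem _
      (AddSubmonoid.subset_closure r.2) _, rfl⟩
  have hp : LinearIndependent ℤ p := by
    rw [Fintype.linearIndependent_iff]
    intro c hc
    -- Split the relation into its positive and negative parts; these give two points of the graph
    -- over the same argument.
    have hval := hsf (hmem fun r => (c r).toNat)
    have hval' := hsf (hmem fun r => (-c r).toNat)
    have hsome : ∀ i, (∑ r, (c r).toNat • r.1 : Option (Fin n) → ℤ) (some i) =
        (∑ r, (-c r).toNat • r.1 : Option (Fin n) → ℤ) (some i) := by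
      intro i
      have := congrFun hc i
      simp only [Finset.sum_apply, Pi.smul_apply, smul_eq_mul, Pi.zero_apply, p] at this
      rw [← sub_eq_zero, Finset.sum_apply, Finset.sum_apply, ← Finset.sum_sub_distrib, ← this]
      refine Finset.sum_congr rfl fun r _ => ?_
      simp only [Pi.smul_apply, nsmul_eq_mul, ← sub_mul]
      congr 1
      omega
    have hsum : ∑ r, (c r).toNat • r.1 = ∑ r, (-c r).toNat • r.1 := by
      funext o
      cases o with
      | some i => exact hsome i
      | none =>
        have hx : ((a + ∑ r, (c r).toNat • r.1) ∘ some : Fin n → ℤ) =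
            (a + ∑ r, (-c r).toNat • r.1) ∘ some := by
          funext i
          simp only [Function.comp_apply, Pi.add_apply, hsome]
        have h1 : f _ = _ := hval
        have h2 : f _ = _ := hval'
        rw [hx, h2] at h1
        simpa using h1.symm
    intro r
    have := Fintype.linearIndependent_iffₛ.1 ht (fun r => (c r).toNat) (fun r => (-c r).toNat)
      hsum r
    omega
  obtain ⟨D, l, hD, hl⟩ := exists_dual_vectors hp
  -- The coefficients of `x - a` with respect to the periods.
  let m : t → (Fin n → ℤ) → ℤ := fun r x => (∑ i, l r i * (x i - a (some i)) + 0) / D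
  have hm (r) : Computes F (m r) :=
    (Computes.linear _ _ fun i => (computes_input i).sub (computes_const _)).ediv hdiv hD
  have hcomb (o : Option (Fin n)) : Computes F fun x => a o + ∑ r, r.1 o * m r x :=
    (computes_const _).add (Computes.sum _ fun r => (hm r).const_mul _)
  refine ⟨fun x => ∑ i, |x i - (a (some i) + ∑ r, r.1 (some i) * m r x)| + ∑ r, max 0 (-m r x),
    fun x => a none + ∑ r, r.1 none * m r x,
    (Computes.sum _ fun i => ((computes_input i).sub (hcomb _)).abs hmax).add
      (Computes.sum _ fun r => (computes_const 0).max hmax (hm r).neg), hcomb _, ?_, ?_⟩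
  · intro x hx
    have h1 : 0 ≤ ∑ i, |x i - (a (some i) + ∑ r, r.1 (some i) * m r x)| :=
      Finset.sum_nonneg fun i _ => abs_nonneg _
    have h2 : 0 ≤ ∑ r, max 0 (-m r x) := Finset.sum_nonneg fun r _ => le_max_left _ _
    obtain ⟨h1', h2'⟩ := (add_eq_zero_iff_of_nonneg h1 h2).1 hx
    rw [Finset.sum_eq_zero_iff_of_nonneg fun i _ => abs_nonneg _] at h1'
    rw [Finset.sum_eq_zero_iff_of_nonneg fun r _ => le_max_left _ _] at h2'
    have hm0 (r) : ((m r x).toNat : ℤ) = m r x := by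
      have := h2' r (Finset.mem_univ _)
      rw [max_eq_left_iff] at this
      omega
    have hv (o) : (a + ∑ r, (m r x).toNat • r.1 : Option (Fin n) → ℤ) o =
        a o + ∑ r, r.1 o * m r x := by
      simp [Finset.sum_apply, hm0, mul_comm]
    have hf : f _ = _ := hsf (hmem fun r => (m r x).toNat)
    rw [hv] at hf
    refine hf.symm.trans (congrArg f ?_)
    funext i
    rw [Function.comp_apply, hv]
    have := h1' i (Finset.mem_univ _)
    rw [abs_eq_zero] at this
    omega
  · rintro _ ⟨y, hy, rfl⟩
    obtain ⟨k, rfl⟩ := AddSubmonoid.mem_closure_finset'.1 hy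
    have hk (o) : (∑ r, k r • r.1 : Option (Fin n) → ℤ) o = ∑ r, r.1 o * k r := by
      simp [Finset.sum_apply, mul_comm]
    have hmk (r) : m r ((a + ∑ r, k r • r.1) ∘ some) = k r := by
      have : ∑ i, l r i * (∑ s : t, s.1 (some i) * (k s : ℤ)) = k r * D := by
        simp_rw [Finset.mul_sum]
        rw [Finset.sum_comm]
        simp_rw [← mul_assoc, ← Finset.sum_mul]
        simp only [p] at hl
        simp [hl, mul_comm]
      simp only [m, Function.comp_apply, Pi.add_apply, add_sub_cancel_left, hk, add_zero, this]
      exact Int.mul_ediv_cancel _ (by exact_mod_cast hD)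
    simp only [vadd_eq_add, hmk, Function.comp_apply, Pi.add_apply, hk, sub_self, abs_zero]
    simp

/-- Presburger-definable functions are computed by circuits. -/
theorem presburgerDefinable_subset_computable {F : Set IntFunction} (hmax : maxFun ∈ F)
    (hcond : condFun ∈ F) (hdiv : ∀ p : ℕ, p.Prime → divFun p ∈ F) :
    presburgerDefinable ⊆ computable F := by
  intro φ hφ
  refine mem_computable_of_computes fun j => ?_
  set f := fun x => φ.toFun x j
  obtain ⟨S, hS, hSlin, hSf⟩ := (isSemilinearSet_of_definable (hφ j)).isProperSemilinearSet
  have key : ∀ T : Set (Set (Option (Fin φ.ins) → ℤ)), T.Finite → T ⊆ S →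
      ∃ g, Computes F g ∧ ∀ v ∈ ⋃₀ T, g (v ∘ some) = f (v ∘ some) := by
    intro T hT
    induction T, hT using Finite.induction_on with
    | empty => exact fun _ => ⟨_, computes_const 0, by simp⟩
    | @insert s T _ _ ih =>
      intro hTS
      obtain ⟨h, hh, hhf⟩ := ih ((subset_insert _ _).trans hTS)
      have hsS := hTS (mem_insert s T)
      obtain ⟨c, g, hc, hg, hcg, hcs⟩ := exists_computes_of_isProperLinearSet hmax hdiv
        (hSlin s hsS) (hSf ▸ subset_sUnion_of_mem hsS)
      refine ⟨_, hc.ite hcond hg hh, fun v hv => ?_⟩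
      by_cases hv0 : c (v ∘ some) = 0
      · simpa [hv0] using hcg _ hv0
      · rw [sUnion_insert] at hv
        simpa [hv0] using hhf v (hv.resolve_left fun hvs => hv0 (hcs v hvs))
  obtain ⟨g, hg, hgf⟩ := key S hS subset_rfl
  refine hg.of_eq fun x => ?_
  exact hgf (fun o => o.elim (f x) x) (hSf ▸ rfl)

end

/-! ### Invariants of circuits -/

section

open Set Filter

/-- `f` maps families of functions `T → ℤ` with property `P` to functions with property `P`. -/
def Preserves {T : Type*} (P : (T → ℤ) → Prop) (f : IntFunction) : Prop :=
  ∀ u : Fin f.ins → T → ℤ, (∀ i, P (u i)) → ∀ j, P fun t => f.toFun (fun i => u i t) j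

/-- `P` holds for constants and is closed under integer linear combinations. -/
structure IsAffineClosed {T : Type*} (P : (T → ℤ) → Prop) : Prop where
  const : ∀ b : ℤ, P fun _ => b
  add : ∀ g h : T → ℤ, P g → P h → P fun t => g t + h t
  const_mul : ∀ (a : ℤ) (g : T → ℤ), P g → P fun t => a * g t

lemma IsAffineClosed.linear {T : Type*} {P : (T → ℤ) → Prop} (hP : IsAffineClosed P) {k : ℕ}
    (a : Fin k → ℤ) (b : ℤ) {g : Fin k → T → ℤ} (hg : ∀ i, P (g i)) :
    P fun t => ∑ i, a i * g i t + b := by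
  refine hP.add _ _ ?_ (hP.const b)
  induction k with
  | zero => simpa using hP.const 0
  | succ k ih =>
    simp only [Fin.sum_univ_succ]
    exact hP.add _ _ (hP.const_mul _ _ (hg 0)) (ih (fun i => a i.succ) fun i => hg i.succ)

/-- A circuit has finitely many gates, so a property that each gate preserves along a filter is
preserved by the circuit along that filter. -/
lemma eventually_preserves_of_mem_computable {ι T : Type*} {l : Filter ι}
    {P : ι → (T → ℤ) → Prop} (hP : ∀ᶠ p in l, IsAffineClosed (P p)) {F : Set IntFunction}
    (hF : ∀ f ∈ F, ∀ᶠ p in l, Preserves (P p) f) {f : IntFunction} (hf : f ∈ computable F) :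
    ∀ᶠ p in l, Preserves (P p) f := by
  obtain ⟨w, C, out, hf⟩ := hf
  suffices h : ∀ᶠ p in l, ∀ u : Fin f.ins → T → ℤ, (∀ i, P p (u i)) →
      ∀ i, P p fun t => C.eval (fun k => u k t) i by
    filter_upwards [h] with p hp u hu j
    simpa only [hf] using hp u hu (out j)
  clear hf out
  induction C with
  | inputs => exact .of_forall fun p u hu => hu
  | linear C a b src ih =>
    filter_upwards [ih, hP] with p hp hPp u hu
    refine Fin.addCases (fun i => ?_) (fun i => ?_)
    · simpa only [Circuit.eval, Fin.append_left] using hp u hu i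
    · simpa only [Circuit.eval, Fin.append_right] using hPp.linear a b fun i => hp u hu (src i)
  | gate C g hg src ih =>
    filter_upwards [ih, hF g hg] with p hp hgp u hu
    refine Fin.addCases (fun i => ?_) (fun i => ?_)
    · simpa only [Circuit.eval, Fin.append_left] using hp u hu i
    · simpa only [Circuit.eval, Fin.append_right] using hgp _ (fun k => hp u hu (src k)) i

lemma preserves_of_mem_computable {T : Type*} {P : (T → ℤ) → Prop} (hP : IsAffineClosed P)
    {F : Set IntFunction} (hF : ∀ f ∈ F, Preserves P f) {f : IntFunction}
    (hf : f ∈ computable F) : Preserves P f := by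
  simpa using eventually_preserves_of_mem_computable (l := (⊤ : Filter Unit)) (P := fun _ => P)
    (by simpa using hP) (by simpa using hF) hf

lemma subset_computable (F : Set IntFunction) : F ⊆ computable F := by
  intro f hf
  exact mem_computable_of_computes fun j => Computes.gate hf (fun i => computes_input i) j

section Preserves

variable {T : Type*} {P : (T → ℤ) → Prop}

lemma preserves_maxFun (h : ∀ u v, P u → P v → P fun t => max (u t) (v t)) :
    Preserves P maxFun :=
  fun _ hu _ => h _ _ (hu (0 : Fin 2)) (hu (1 : Fin 2))

lemma preserves_condFun (h : ∀ u v, P u → P v → P fun t => if u t = 0 then v t else 0) :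
    Preserves P condFun :=
  fun _ hu _ => h _ _ (hu (0 : Fin 2)) (hu (1 : Fin 2))

lemma preserves_divFun {p : ℕ} (h : ∀ u, P u → P fun t => u t / (p : ℤ)) :
    Preserves P (divFun p) := by
  intro u hu _
  convert h _ (hu (0 : Fin 1)) using 2
  exact Rat.floor_intCast_div_natCast _ _

lemma Preserves.max (hP : Preserves P maxFun) {u v : T → ℤ} (hu : P u) (hv : P v) :
    P fun t => max (u t) (v t) :=
  hP ![u, v] (Fin.forall_fin_two.2 ⟨hu, hv⟩) (0 : Fin 1)

lemma Preserves.cond (hP : Preserves P condFun) {u v : T → ℤ} (hu : P u) (hv : P v) :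
    P fun t => if u t = 0 then v t else 0 :=
  hP ![u, v] (Fin.forall_fin_two.2 ⟨hu, hv⟩) (0 : Fin 1)

lemma Preserves.div {p : ℕ} (hP : Preserves P (divFun p)) {u : T → ℤ} (hu : P u) :
    P fun t => u t / (p : ℤ) := by
  convert hP ![u] (fun i => by rw [Subsingleton.elim (α := Fin 1) i 0]; exact hu)
    (0 : Fin 1) using 2
  exact (Rat.floor_intCast_div_natCast _ _).symm

end Preserves

/-! ### Eventually affine functions -/

/-- Along the filter `l`, the function `g` is affine on the multiples of some `M > 0` that
satisfies `Q`. -/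
def EventuallyAffine (l : Filter ℤ) (Q : ℤ → Prop) (g : ℤ → ℤ) : Prop :=
  ∃ M : ℤ, 0 < M ∧ Q M ∧ ∃ a b : ℤ, ∀ᶠ k in l, g (M * k) = a * k + b

section EventuallyAffine

variable {l : Filter ℤ} {Q : ℤ → Prop} {g h : ℤ → ℤ}

lemma EventuallyAffine.const (h1 : Q 1) (b : ℤ) : EventuallyAffine l Q fun _ => b :=
  ⟨1, one_pos, h1, 0, b, .of_forall fun k => by ring⟩

lemma EventuallyAffine.id (h1 : Q 1) : EventuallyAffine l Q fun x => x :=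
  ⟨1, one_pos, h1, 1, 0, .of_forall fun k => by ring⟩

/-- Two eventually affine functions are affine on the multiples of a common `M`. -/
lemma EventuallyAffine.common (hl : ∀ M : ℤ, 0 < M → Tendsto (M * ·) l l)
    (hQ : ∀ M N, Q M → Q N → Q (M * N)) (hg : EventuallyAffine l Q g)
    (hh : EventuallyAffine l Q h) :
    ∃ M : ℤ, 0 < M ∧ Q M ∧ ∃ a b c d : ℤ,
      ∀ᶠ k in l, g (M * k) = a * k + b ∧ h (M * k) = c * k + d := by
  obtain ⟨M, hM, hQM, a, b, hg⟩ := hg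
  obtain ⟨N, hN, hQN, c, d, hh⟩ := hh
  refine ⟨M * N, mul_pos hM hN, hQ _ _ hQM hQN, a * N, b, c * M, d, ?_⟩
  filter_upwards [(hl N hN).eventually hg, (hl M hM).eventually hh] with k h1 h2
  constructor
  · rw [mul_assoc, h1, mul_assoc]
  · rw [mul_comm M, mul_assoc, h2, mul_assoc]

lemma EventuallyAffine.isAffineClosed (hl : ∀ M : ℤ, 0 < M → Tendsto (M * ·) l l)
    (hQ : ∀ M N, Q M → Q N → Q (M * N)) (h1 : Q 1) : IsAffineClosed (EventuallyAffine l Q) where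
  const := .const h1
  add g h hg hh := by
    obtain ⟨M, hM, hQM, a, b, c, d, H⟩ := hg.common hl hQ hh
    refine ⟨M, hM, hQM, a + c, b + d, H.mono fun k hk => ?_⟩
    simp only [hk.1, hk.2]
    ring
  const_mul e g hg := by
    obtain ⟨M, hM, hQM, a, b, H⟩ := hg
    refine ⟨M, hM, hQM, e * a, e * b, H.mono fun k hk => ?_⟩
    simp only [hk]
    ring

/-- An affine function of `k` is identically zero, or zero at most once. -/
lemma EventuallyAffine.preserves_condFun (hl : ∀ M : ℤ, 0 < M → Tendsto (M * ·) l l)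
    (hlc : l ≤ cofinite) (hQ : ∀ M N, Q M → Q N → Q (M * N)) :
    Preserves (EventuallyAffine l Q) condFun := by
  refine PresburgerCircuits.preserves_condFun fun u v hu hv => ?_
  obtain ⟨M, hM, hQM, a, b, c, d, H⟩ := hu.common hl hQ hv
  by_cases hab : a = 0 ∧ b = 0
  · refine ⟨M, hM, hQM, c, d, H.mono fun k hk => ?_⟩
    simp [hk.1, hk.2, hab.1, hab.2]
  · refine ⟨M, hM, hQM, 0, 0, ?_⟩
    have hfin : {k : ℤ | a * k + b = 0}.Finite := by
      refine Set.Subsingleton.finite fun x hx y hy => ?_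
      have hx' : a * x + b = 0 := hx
      have hy' : a * y + b = 0 := hy
      have h0 : a * (x - y) = 0 := by linear_combination hx' - hy'
      rcases mul_eq_zero.1 h0 with h0 | h0
      · exact absurd ⟨h0, by simpa [h0] using hx'⟩ hab
      · omega
    filter_upwards [H, hlc hfin.compl_mem_cofinite] with k hk hk'
    have : a * k + b ≠ 0 := hk'
    simp [hk.1, this]

lemma EventuallyAffine.preserves_divFun (hl : ∀ M : ℤ, 0 < M → Tendsto (M * ·) l l)
    (hQ : ∀ M N, Q M → Q N → Q (M * N)) {p : ℕ} (hp : p ≠ 0) (hQp : Q p) :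
    Preserves (EventuallyAffine l Q) (divFun p) := by
  refine PresburgerCircuits.preserves_divFun fun u hu => ?_
  obtain ⟨M, hM, hQM, a, b, H⟩ := hu
  have hp' : (0 : ℤ) < p := by positivity
  refine ⟨M * p, mul_pos hM hp', hQ _ _ hQM hQp, a, b / p, ?_⟩
  filter_upwards [(hl p hp').eventually H] with k hk
  rw [mul_assoc, hk, show a * (p * k) + b = b + p * (a * k) by ring,
    Int.add_mul_ediv_left _ _ hp'.ne', add_comm]

end EventuallyAffine

lemma tendsto_const_mul_cofinite {M : ℤ} (hM : 0 < M) : Tendsto (M * ·) cofinite cofinite :=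
  (mul_right_injective₀ hM.ne').tendsto_cofinite

lemma tendsto_const_mul_atTop {M : ℤ} (hM : 0 < M) : Tendsto (M * ·) atTop (atTop : Filter ℤ) :=
  tendsto_id.const_mul_atTop' hM

/-- `k ↦ max k 0` has different slopes at `+∞` and at `-∞`. -/
lemma not_preserves_maxFun :
    ¬ Preserves (EventuallyAffine cofinite fun _ => True) maxFun := by
  intro hP
  obtain ⟨M, hM, -, a, b, H⟩ := hP.max (EventuallyAffine.id trivial) (.const trivial 0)
  rw [Int.cofinite_eq, eventually_sup] at H
  obtain ⟨H₁, H₂⟩ := H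
  obtain ⟨N₁, h₁⟩ := eventually_atBot.1 H₁
  obtain ⟨N₂, h₂⟩ := eventually_atTop.1 H₂
  have e₁ := h₁ (min N₁ 0) (min_le_left _ _)
  have e₁' := h₁ (min N₁ 0 - 1) (by omega)
  have e₂ := h₂ (max N₂ 1) (le_max_left _ _)
  beta_reduce at e₁ e₁' e₂
  have hneg : M * min N₁ 0 ≤ 0 := mul_nonpos_of_nonneg_of_nonpos hM.le (min_le_right _ _)
  have hpos : 0 < M * max N₂ 1 := mul_pos hM (lt_max_of_lt_right one_pos)
  rw [max_eq_right hneg] at e₁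
  rw [max_eq_right (by linarith)] at e₁'
  have ha : a = 0 := by linarith
  rw [max_eq_left hpos.le] at e₂
  simp only [ha, zero_mul, zero_add] at e₁ e₂
  omega

/-- If `⌊M k / p⌋ = a k + b` for all large `k`, then comparing `k` with `k + p` gives `M = a p`. -/
lemma not_preserves_divFun {p : ℕ} (hp : p.Prime) :
    ¬ Preserves (EventuallyAffine atTop fun M => ¬ (p : ℤ) ∣ M) (divFun p) := by
  intro hP
  have hp0 : (p : ℤ) ≠ 0 := by exact_mod_cast hp.ne_zero
  have h1 : ¬ (p : ℤ) ∣ 1 := by exact_mod_cast hp.one_lt.ne' ∘ Nat.dvd_one.1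
  obtain ⟨M, -, hpM, a, b, H⟩ := hP.div (EventuallyAffine.id h1)
  obtain ⟨N, hN⟩ := eventually_atTop.1 H
  have e1 := hN N le_rfl
  have e2 := hN (N + p) (by omega)
  beta_reduce at e1 e2
  rw [mul_add, mul_comm M p, Int.add_mul_ediv_left _ _ hp0, e1] at e2
  exact hpM ⟨a, by linear_combination e2⟩

lemma preserves_maxFun_atTop {Q : ℤ → Prop} (hQ : ∀ M N, Q M → Q N → Q (M * N)) :
    Preserves (EventuallyAffine atTop Q) maxFun := by
  refine preserves_maxFun fun u v hu hv => ?_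
  obtain ⟨M, hM, hQM, a, b, c, d, H⟩ := hu.common (fun M => tendsto_const_mul_atTop) hQ hv
  -- For large `k`, the affine function that is lexicographically larger wins.
  have key : ∀ a b c d : ℤ, (a < c ∨ a = c ∧ b ≤ d) → ∀ᶠ k : ℤ in atTop, a * k + b ≤ c * k + d := by
    rintro a b c d (h | ⟨rfl, h⟩)
    · filter_upwards [eventually_ge_atTop (max 0 (b - d))] with k hk
      nlinarith [le_max_left 0 (b - d), le_max_right 0 (b - d)]
    · exact .of_forall fun k => by linarith
  by_cases h : a < c ∨ a = c ∧ b ≤ d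
  · refine ⟨M, hM, hQM, c, d, ?_⟩
    filter_upwards [H, key _ _ _ _ h] with k hk hk'
    rw [hk.1, hk.2, max_eq_right hk']
  · refine ⟨M, hM, hQM, a, b, ?_⟩
    filter_upwards [H, key c d a b (by omega)] with k hk hk'
    rw [hk.1, hk.2, max_eq_left hk']

/-! ### Functions with a bounded gap between two copies of `ℤ` -/

/-- The restrictions of `g` to the two copies of `ℤ` have bounded distance. -/
def BoundedGap (g : ℤ × Bool → ℤ) : Prop :=
  ∃ C : ℤ, ∀ y, |g (y, false) - g (y, true)| ≤ C

lemma isAffineClosed_boundedGap : IsAffineClosed BoundedGap where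
  const b := ⟨0, by simp⟩
  add := by
    rintro g h ⟨C, hC⟩ ⟨D, hD⟩
    refine ⟨C + D, fun y => ?_⟩
    rw [add_sub_add_comm]
    exact (abs_add_le _ _).trans (add_le_add (hC y) (hD y))
  const_mul := by
    rintro a g ⟨C, hC⟩
    refine ⟨|a| * C, fun y => ?_⟩
    rw [← mul_sub, abs_mul]
    exact mul_le_mul_of_nonneg_left (hC y) (abs_nonneg a)

lemma preserves_boundedGap_maxFun : Preserves BoundedGap maxFun := by
  refine preserves_maxFun ?_
  rintro u v ⟨C, hC⟩ ⟨D, hD⟩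
  exact ⟨max C D, fun y => (abs_max_sub_max_le_max _ _ _ _).trans (max_le_max (hC y) (hD y))⟩

lemma preserves_boundedGap_divFun {p : ℕ} (hp : p ≠ 0) : Preserves BoundedGap (divFun p) := by
  refine preserves_divFun ?_
  rintro u ⟨C, hC⟩
  have hp' : (0 : ℤ) < p := by positivity
  refine ⟨C + 1, fun y => ?_⟩
  have key : ∀ a b : ℤ, a - b ≤ C → 0 ≤ C → a / p - b / p ≤ C + 1 := by
    intro a b h h0
    have h1 := Int.ediv_mul_le a hp'.ne'
    have h2 := Int.lt_ediv_add_one_mul_self b hp'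
    by_contra! h3
    nlinarith
  have hy := abs_le.1 (hC y)
  have h0 := (abs_nonneg _).trans (hC y)
  have h1 := key _ _ hy.2 h0
  have h2 := key (u (y, true)) (u (y, false)) (by linarith) h0
  exact abs_le.2 ⟨by linarith, h1⟩

/-- The functions `0 / 1` (on the two copies) and `y` have bounded gap, but `E` turns them into `y`
on the first copy and `0` on the second. -/
lemma not_preserves_boundedGap_condFun : ¬ Preserves BoundedGap condFun := by
  intro hP
  obtain ⟨C, hC⟩ := hP.cond (u := fun t => if t.2 then 1 else 0) (v := fun t => t.1)
    ⟨1, by simp⟩ ⟨0, by simp⟩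
  have := hC (C + 1)
  simp at this
  have := (le_abs_self _).trans this
  omega

/-! ### Completeness and minimality -/

lemma isPresburgerComplete_of_subset {F : Set IntFunction} (hF : F ⊆ presburgerDefinable)
    (hB : primePresburgerBasis ⊆ F) : IsPresburgerComplete F :=
  (computable_subset_presburgerDefinable hF).antisymm <|
    presburgerDefinable_subset_computable (hB (.inl (.inl rfl))) (hB (.inl (.inr rfl)))
      fun p hp => hB (.inr ⟨p, hp, rfl⟩)

lemma presburgerBasis_subset_presburgerDefinable : presburgerBasis ⊆ presburgerDefinable := by
  rintro f ((rfl | rfl) | ⟨m, hm, rfl⟩)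
  · exact maxFun_mem_presburgerDefinable
  · exact condFun_mem_presburgerDefinable
  · exact divFun_mem_presburgerDefinable hm

lemma primePresburgerBasis_subset_presburgerBasis : primePresburgerBasis ⊆ presburgerBasis :=
  union_subset_union_right _ fun _ ⟨p, hp, hf⟩ => ⟨p, by exact_mod_cast hp.ne_zero, hf⟩

/-- A Presburger-complete set cannot preserve a property that some Presburger-definable function
fails to preserve. -/
lemma not_isPresburgerComplete_of_preserves {T : Type*} {P : (T → ℤ) → Prop}
    (hP : IsAffineClosed P) {F : Set IntFunction} (hF : ∀ f ∈ F, Preserves P f) {f : IntFunction}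
    (hf : f ∈ presburgerDefinable) (hfP : ¬ Preserves P f) : ¬ IsPresburgerComplete F :=
  fun h => hfP (preserves_of_mem_computable hP hF (h.symm ▸ hf))

lemma isAffineClosed_eventuallyAffine_not_dvd {p : ℕ} (hp : p.Prime) :
    IsAffineClosed (EventuallyAffine atTop fun M => ¬ (p : ℤ) ∣ M) :=
  EventuallyAffine.isAffineClosed (fun _ => tendsto_const_mul_atTop)
    (fun _ _ => (Nat.prime_iff_prime_int.1 hp).not_dvd_mul)
    (by exact_mod_cast hp.one_lt.ne' ∘ Nat.dvd_one.1)

lemma preserves_eventuallyAffine_not_dvd {p : ℕ} (hp : p.Prime) {f : IntFunction}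
    (hf : f ∈ ({maxFun, condFun} ∪ {f | ∃ q : ℕ, q.Prime ∧ q ≠ p ∧ f = divFun q} :
      Set IntFunction)) :
    Preserves (EventuallyAffine atTop fun M => ¬ (p : ℤ) ∣ M) f := by
  have hQ : ∀ M N : ℤ, ¬ (p : ℤ) ∣ M → ¬ (p : ℤ) ∣ N → ¬ (p : ℤ) ∣ M * N :=
    fun _ _ => (Nat.prime_iff_prime_int.1 hp).not_dvd_mul
  rcases hf with (rfl | rfl) | ⟨q, hq, hqp, rfl⟩
  · exact preserves_maxFun_atTop hQ
  · exact EventuallyAffine.preserves_condFun (fun _ => tendsto_const_mul_atTop)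
      atTop_le_cofinite hQ
  · refine EventuallyAffine.preserves_divFun (fun _ => tendsto_const_mul_atTop) hQ hq.ne_zero
      fun h => hqp ((Nat.prime_dvd_prime_iff_eq hp hq).1 (Int.natCast_dvd_natCast.1 h)).symm

theorem isPresburgerComplete_primePresburgerBasis : IsPresburgerComplete primePresburgerBasis :=
  isPresburgerComplete_of_subset
    (primePresburgerBasis_subset_presburgerBasis.trans presburgerBasis_subset_presburgerDefinable)
    subset_rfl

theorem isMinimallyPresburgerComplete_primePresburgerBasis :
    IsMinimallyPresburgerComplete primePresburgerBasis := by
  refine ⟨isPresburgerComplete_primePresburgerBasis, ?_⟩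
  rintro f ((rfl | rfl) | ⟨p, hp, rfl⟩)
  · have hl := fun M : ℤ => tendsto_const_mul_cofinite (M := M)
    refine not_isPresburgerComplete_of_preserves
      (EventuallyAffine.isAffineClosed hl (fun _ _ _ _ => trivial) trivial) ?_
      maxFun_mem_presburgerDefinable not_preserves_maxFun
    rintro f ⟨(rfl | rfl) | ⟨q, hq, rfl⟩, hf⟩
    · exact absurd rfl hf
    · exact EventuallyAffine.preserves_condFun hl le_rfl fun _ _ _ _ => trivial
    · exact EventuallyAffine.preserves_divFun hl (fun _ _ _ _ => trivial) hq.ne_zero trivial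
  · refine not_isPresburgerComplete_of_preserves isAffineClosed_boundedGap ?_
      condFun_mem_presburgerDefinable not_preserves_boundedGap_condFun
    rintro f ⟨(rfl | rfl) | ⟨q, hq, rfl⟩, hf⟩
    · exact preserves_boundedGap_maxFun
    · exact absurd rfl hf
    · exact preserves_boundedGap_divFun hq.ne_zero
  · refine not_isPresburgerComplete_of_preserves (isAffineClosed_eventuallyAffine_not_dvd hp)
      (fun f hf => preserves_eventuallyAffine_not_dvd hp ?_)
      (divFun_mem_presburgerDefinable (by exact_mod_cast hp.ne_zero)) (not_preserves_divFun hp)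
    refine hf.1.imp_right fun ⟨q, hq, hfq⟩ => ⟨q, hq, ?_, hfq⟩
    rintro rfl
    exact hf.2 hfq

/-- Finitely many functions are computed with divisions by finitely many primes, hence they all
preserve the invariant attached to any other prime. -/
theorem not_isPresburgerComplete_of_finite {F : Set IntFunction} (hF : F.Finite) :
    ¬ IsPresburgerComplete F := by
  intro hc
  have hev : ∀ᶠ p : Nat.Primes in cofinite, ∀ f ∈ F,
      Preserves (EventuallyAffine atTop fun M => ¬ ((p : ℕ) : ℤ) ∣ M) f := by
    refine hF.eventually_all.2 fun f hf => ?_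
    refine eventually_preserves_of_mem_computable (F := primePresburgerBasis)
      (.of_forall fun p => isAffineClosed_eventuallyAffine_not_dvd p.2) (fun g hg => ?_) ?_
    · rcases hg with hg | ⟨q, hq, rfl⟩
      · exact .of_forall fun p => preserves_eventuallyAffine_not_dvd p.2 (.inl hg)
      · filter_upwards [eventually_cofinite_ne ⟨q, hq⟩] with p hp
        exact preserves_eventuallyAffine_not_dvd p.2
          (.inr ⟨q, hq, fun h => hp (Subtype.ext h.symm), rfl⟩)
    · rw [show computable _ = _ from isPresburgerComplete_primePresburgerBasis, ← hc]
      exact subset_computable F hf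
  obtain ⟨p, hp⟩ := hev.exists
  exact not_isPresburgerComplete_of_preserves (isAffineClosed_eventuallyAffine_not_dvd p.2) hp
    (divFun_mem_presburgerDefinable (by exact_mod_cast p.2.ne_zero)) (not_preserves_divFun p.2) hc

end

end PresburgerCircuits

theorem mainTheorem9 :
    PresburgerCircuits.IsPresburgerComplete PresburgerCircuits.presburgerBasis ∧
    PresburgerCircuits.IsMinimallyPresburgerComplete PresburgerCircuits.primePresburgerBasis ∧
    ∀ F : Set PresburgerCircuits.IntFunction,
      F.Finite → ¬ PresburgerCircuits.IsPresburgerComplete F :=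
  ⟨PresburgerCircuits.isPresburgerComplete_of_subset
      PresburgerCircuits.presburgerBasis_subset_presburgerDefinable
      PresburgerCircuits.primePresburgerBasis_subset_presburgerBasis,
    PresburgerCircuits.isMinimallyPresburgerComplete_primePresburgerBasis,
    fun _ => PresburgerCircuits.not_isPresburgerComplete_of_finite⟩
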